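/- Let $H\le\mathbb{Q}_+^\times$ be a subgroup of the multiplicative group of positive rational numbers, let $R:=\mathbb{Z}H$ be its group ring, and write $x_h\in R$ for the basis element corresponding to $h\in H$. For $n\ge 0$ let $\{0,1\}^n$ be the set of binary sequences of length $n$; for $y\in\{0,1\}^n$ let $y0,y1\in\{0,1\}^{n+1}$ be the sequences obtained by appending $0$, respectively $1$, at the end. Then there exist - an $R$-module $G$ whose underlying abelian group is reduced (it has no nonzero divisible subgroup), - a finite subset $F_n\subseteq H$ for every integer $n\ge 1$, - positive integers $s_n,t_n,k_n,l_n$ for every integer $n\ge 0$, - submodules $G_n\subseteq G$ ($n\ge0$), elements $c_i^{(n)}\in G$ ($1\le i\le n$), and an element of $G$ for each finite binary sequence $y$, again denoted by $y$, such that the following hold. 1. $\operatorname{Aut}G=\pm H$: the map $\{1,-1\}\times H\to\operatorname{Aut}G$, $(\varepsilon,h)\mapsto(g\mapsto\varepsilon x_hg)$, is an isomorphism onto the group of all automorphisms of the abelian group $G$. 2. (a) $G_0\subseteq G_1\subseteq G_2\subseteq\cdots$ are free submodules with $\bigcup_{n\ge0}G_n=G$. (b) For every $n\ge 0$, the elements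 $y$ for $y\in\{0,1\}^n$ together with $c_1^{(n)},\dots,c_n^{(n)}$ form a basis (without repetition) of the $R$-module $G_n$. 3. (a) $y=y0+s_n^2\cdot y1$ in $G$ for all $n\ge0$ and $y\in\{0,1\}^n$. (b) For all $1\le i\le n$ there are integers $n^{(i)}_{h,y}$ (depending also on $n$), for $h\in H$ and $y\in\{0,1\}^n$, such that $$c_i^{(n)}-s_nt_n\,c_i^{(n+1)}=\sum_{h\in F_i}\ \sum_{y\in\{0,1\}^n}n^{(i)}_{h,y}\,x_h\cdot y0,\qquad 0\le n^{(i)}_{h,y}<s_nt_n.$$ 4. (a) $k_0=l_0=1$, and $k_{n+1}=s_nk_n$, $l_{n+1}=t_nl_n$ for all $n\ge0$. (b) Every positive integer divides both $k_n$ and $l_n$ for all sufficiently large $n$. (c) For all $n\ge0$, $$k_n(s_n^2-1)\ \ge\ l_ns_nt_n\sum_{i=1}^n\sum_{h\in F_i}h .$$ -/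

import Mathlib

/-- An abelian group is reduced if its only divisible subgroup is the trivial one. -/
def IsReducedAddGroup (G : Type*) [AddCommGroup G] : Prop :=
  ∀ D : AddSubgroup G, Nonempty (DivisibleBy D ℤ) → D = ⊥

/-- The action of a group `H` on a `ℤH`-module `G` by the automorphisms `g ↦ x_h g`
of the abelian group `G`, where `x_h = MonoidAlgebra.of ℤ H h`. (Mathlib writes the composition
of elements of `AddAut G` additively; `Multiplicative` makes it the usual product.) -/
noncomputable def groupRingAct (H G : Type*) [Group H] [AddCommGroup G]
    [Module (MonoidAlgebra ℤ H) G] : H →* Multiplicative (AddAut G) :=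
  (DistribMulAction.toAddAut (MonoidAlgebra ℤ H)ˣ G).comp
    (MonoidHom.toHomUnits (MonoidAlgebra.of ℤ H))

theorem groupRingAct_apply (H G : Type*) [Group H] [AddCommGroup G]
    [Module (MonoidAlgebra ℤ H) G] (h : H) (g : G) :
    (groupRingAct H G h).toAdd g = MonoidAlgebra.of ℤ H h • g := rfl

/-- The homomorphism `{1, -1} × H → Aut G`, `(ε, h) ↦ (g ↦ ε x_h g)`, for a `ℤH`-module `G`. -/
noncomputable def plusMinusAct (H G : Type*) [Group H] [AddCommGroup G]
    [Module (MonoidAlgebra ℤ H) G] : ℤˣ × H →* Multiplicative (AddAut G) :=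
  MonoidHom.noncommCoprod (DistribMulAction.toAddAut ℤˣ G) (groupRingAct H G) (by
    intro ε h
    apply Multiplicative.toAdd.injective
    ext g
    change (ε : ℤ) • (MonoidAlgebra.of ℤ H h • g) = MonoidAlgebra.of ℤ H h • ((ε : ℤ) • g)
    exact smul_comm _ _ _)

theorem plusMinusAct_apply (H G : Type*) [Group H] [AddCommGroup G]
    [Module (MonoidAlgebra ℤ H) G] (p : ℤˣ × H) (g : G) :
    (plusMinusAct H G p).toAdd g = (p.1 : ℤ) • (MonoidAlgebra.of ℤ H p.2 • g) := rfl

/-- `Aut G = ±H`: the automorphism group of the abelian group `G` is the direct product of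
the two-element group generated by `-1` and of `H`, acting through `x_h`. -/
def AutEqPlusMinus (H G : Type*) [Group H] [AddCommGroup G]
    [Module (MonoidAlgebra ℤ H) G] : Prop :=
  Function.Bijective (plusMinusAct H G)

/-!
The module is a pure dense extension of a free module, in the manner of Corner's theorem on
endomorphism rings.

Let `R = ℤH` and `A = ℚH`. The relations `y = y0 + s_n² y1` alone generate a free `R`-module: with
binary sequences read as numbers, least significant digit first, a sequence of length `n` and code
`v` is `e_v - ∑ s_m² e_{v + 2^m}`, the sum over those `m < n` with `v < 2^m`, and the `e_v` form a
basis. To this free module one adjoins, for every pair `(h, b)` of an element of `H` and a number,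
an element `X e_0 + Y x_h e_b`, where `X` and `Y` are two new variables, together with its
quotients by `P_n = k_n l_n` after subtraction of suitable integers from `X` and `Y`. The variables
stand for algebraically independent 2-adic integers; such exist because `ℚ_[2]` is uncountable
(`exists_algebraicIndependent_padicInt`), and the integers subtracted are approximations of these,
chosen compatibly at the odd primes too (`PadicInt.exists_expansion`). What is used of the 2-adic
numbers is collected in `exists_integral_subring`: a subring of `A[X_j]` that contains all
coordinates of elements of the module and in which no nonzero element is divisible by all `P_n`.
This makes the module reduced, and makes its endomorphisms continuous.

Hence an endomorphism `φ` satisfies `φ (X e_0 + Y x_h e_b) = X φ(e_0) + Y φ(x_h e_b)`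
(`CornerData.map_gen_apply`). All three values of `φ` have degree at most one in the variables.
Comparison of the quadratic coefficients shows that `φ(e_0)` and `φ(x_h e_b)` are constant, and
comparison of the linear ones that they are multiples of `e_0` and `x_h e_b` by the same element of
`R` (`CornerData.exists_map_u_smul_e`). As the quotient by the free module is divisible, `φ` is
multiplication by that element (`CornerData.exists_eq_smul`), so automorphisms are multiplications
by units of `R`; since `H` is an ordered group, these are the `± x_h`
(`MonoidAlgebra.exists_eq_of_mul_eq_one`).

The elements `c_i^{(n)}` are the quotients just described, up to integral combinations of sequences
of length `n`. Division with remainder by `s_n t_n` produces the digits, and the quotients are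
carried to the next level; the carry is integral because `t_n` divides `s_n` (`CornerData.IsComb.step`).
The support `{1, h_i}` of the `i`-th relation does not depend on the multipliers, so `s_n` can
be taken as large as the inequality requires.
-/

/-! ### Algebraically independent 2-adic integers -/

theorem exists_algebraicIndependent_padicInt (J : Type) [Countable J] :
    ∃ γ : J → ℤ_[2], AlgebraicIndependent ℚ (fun j => (γ j : ℚ_[2])) := by
  have hadj : ∀ x : ℚ_[2], x ∈ Algebra.adjoin ℚ {x : ℚ_[2] | ‖x‖ ≤ 1} := by
    intro x
    obtain ⟨n, hn⟩ := pow_unbounded_of_one_lt ‖x‖ (one_lt_two)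
    have h1 : (2 : ℚ_[2]) ^ n * x ∈ {x : ℚ_[2] | ‖x‖ ≤ 1} := by
      have h2 : ‖(2 : ℚ_[2])‖ = 2⁻¹ := by simpa using Padic.norm_p (p := 2)
      simp only [Set.mem_ofPred_eq, norm_mul, norm_pow, h2, inv_pow]
      rw [inv_mul_le_iff₀ (by positivity)]
      linarith
    have h3 := Subalgebra.smul_mem _ (Algebra.subset_adjoin (R := ℚ) h1) ((2 : ℚ) ^ n)⁻¹
    have h4 : ((2 : ℚ) ^ n)⁻¹ • ((2 : ℚ_[2]) ^ n * x) = x := by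
      rw [Algebra.smul_def]
      simp
    rwa [h4] at h3
  have halg : Algebra.IsAlgebraic (Algebra.adjoin ℚ {x : ℚ_[2] | ‖x‖ ≤ 1}) ℚ_[2] :=
    ⟨fun x => isAlgebraic_algebraMap (⟨x, hadj x⟩ : Algebra.adjoin ℚ {x : ℚ_[2] | ‖x‖ ≤ 1})⟩
  obtain ⟨u, -, hu, hb⟩ := exists_isTranscendenceBasis_between (R := ℚ) ∅
    {x : ℚ_[2] | ‖x‖ ≤ 1} (Set.empty_subset _)
    ((algebraicIndependent_empty_iff ..).mpr <| FaithfulSMul.algebraMap_injective ℚ ℚ_[2])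
  have hinf : Infinite u := by
    by_contra hfin
    have hfin : Finite u := not_infinite_iff_finite.mp hfin
    have h1 := hb.isAlgebraic
    have h2 := Algebra.IsAlgebraic.cardinalMk_le_max
      (Algebra.adjoin ℚ (Set.range ((↑) : u → ℚ_[2]))) ℚ_[2]
    have h3 : Countable (Algebra.adjoin ℚ (Set.range ((↑) : u → ℚ_[2]))) := by
      rw [Algebra.adjoin_range_eq_range_aeval]
      have : Countable (MvPolynomial u ℚ) := by
        rw [← Cardinal.mk_le_aleph0_iff]
        exact MvPolynomial.cardinalMk_le_max.trans (by simp)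
      exact (Set.countable_range _).to_subtype
    have h4 := Cardinal.mk_le_aleph0_iff.mpr h3
    have h5 := continuum_le_cardinal_of_nontriviallyNormedField ℚ_[2]
    exact absurd (h5.trans (h2.trans (max_le h4 le_rfl))) (not_le.mpr Cardinal.aleph0_lt_continuum)
  obtain ⟨f⟩ : Nonempty (J ↪ u) := by
    obtain ⟨g, hg⟩ := exists_injective_nat J
    exact ⟨(⟨g, hg⟩ : J ↪ ℕ).trans (Infinite.natEmbedding u)⟩
  exact ⟨fun j => ⟨(f j : ℚ_[2]), hu (f j).2⟩, hb.1.comp f f.injective⟩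

theorem PadicInt.exists_int_sub_eq_mul (z : ℤ_[2]) {q : ℕ} (hq : 0 < q) :
    ∃ (d : ℤ) (w : ℤ_[2]), z - d = q * w := by
  have hq0 : (q : ℤ_[2]) ≠ 0 := by exact_mod_cast hq.ne'
  have h1 := PadicInt.appr_spec (q : ℤ_[2]).valuation z
  rw [Ideal.mem_span_singleton] at h1
  have h2 : (q : ℤ_[2]) ∣ (2 : ℕ) ^ (q : ℤ_[2]).valuation := by
    conv_lhs => rw [PadicInt.unitCoeff_spec hq0]
    rw [Units.mul_left_dvd]
  obtain ⟨w, hw⟩ := h2.trans h1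
  exact ⟨z.appr (q : ℤ_[2]).valuation, w, by exact_mod_cast hw⟩

/-- Every 2-adic integer `z` has an expansion along a divisor chain `P` of positive integers:
integers `a n` with `z ≡ a n` modulo `P n` in `ℤ_[2]` that are compatible modulo `P n` in `ℤ`,
that is, also at the odd primes. -/
theorem PadicInt.exists_expansion (z : ℤ_[2]) {P : ℕ → ℕ} (hP0 : P 0 = 1)
    (hP : ∀ n, 0 < P n) (hdvd : ∀ n, P n ∣ P (n + 1)) :
    ∃ a : ℕ → ℤ, a 0 = 0 ∧ (∀ n, (P n : ℤ) ∣ a (n + 1) - a n) ∧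
      ∀ n, ∃ w : ℤ_[2], z - a n = P n * w := by
  have step : ∀ n (x : {x : ℤ // ∃ w : ℤ_[2], z - x = P n * w}),
      ∃ y : {y : ℤ // ∃ w : ℤ_[2], z - y = P (n + 1) * w}, (P n : ℤ) ∣ y.1 - x.1 := by
    rintro n ⟨x, w, hw⟩
    obtain ⟨q, hq⟩ := hdvd n
    have hq0 : 0 < q := Nat.pos_of_mul_pos_left (hq ▸ hP (n + 1))
    obtain ⟨d, w', hw'⟩ := PadicInt.exists_int_sub_eq_mul w hq0
    refine ⟨⟨x + P n * d, w', ?_⟩, by simp⟩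
    rw [hq]
    push_cast
    linear_combination hw + (P n : ℤ_[2]) * hw'
  choose f hf using step
  let s : ∀ n, {x : ℤ // ∃ w : ℤ_[2], z - x = P n * w} := fun n =>
    Nat.rec ⟨0, z, by simp [hP0]⟩ f n
  exact ⟨fun n => (s n).1, rfl, fun n => hf n (s n), fun n => (s n).2⟩

/-! ### An integral subring of polynomials over the rational group algebra -/

section IntegralSubring

variable (H : Type) [CommGroup H] {J : Type}

/-- The substitution of 2-adic integers `γ j` for the variables, on polynomials with coefficients
in the rational group algebra of `H`; its values lie in the group algebra over `ℚ_[2]`. -/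
noncomputable def padicEval (γ : J → ℤ_[2]) :
    MvPolynomial J (MonoidAlgebra ℚ H) →+* MonoidAlgebra ℚ_[2] H :=
  MvPolynomial.eval₂Hom (MonoidAlgebra.mapRingHom H (algebraMap ℚ ℚ_[2]))
    (fun j => algebraMap ℚ_[2] _ (γ j : ℚ_[2]))

theorem padicEval_injective {γ : J → ℤ_[2]}
    (hγ : AlgebraicIndependent ℚ (fun j => (γ j : ℚ_[2]))) :
    Function.Injective (padicEval H γ) := by
  classical
  rw [injective_iff_map_eq_zero]
  intro f hf
  have key : ∀ h : H, ∑ d ∈ f.support,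
      MvPolynomial.monomial d ((f.coeff d).coeff h) = (0 : MvPolynomial J ℚ) := by
    intro h
    apply hγ
    rw [map_zero, map_sum]
    have h1 : (padicEval H γ f).coeff h = 0 := by rw [hf]; rfl
    rw [padicEval, MvPolynomial.coe_eval₂Hom, MvPolynomial.eval₂_eq,
      MonoidAlgebra.coeff_sum, Finsupp.finsetSum_apply] at h1
    rw [← h1]
    refine Finset.sum_congr rfl fun d _ => ?_
    rw [MvPolynomial.aeval_monomial, Finsupp.prod]
    simp_rw [← map_pow]
    rw [← map_prod, mul_comm _ (algebraMap _ _ _), ← Algebra.smul_def]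
    simp [mul_comm, Algebra.smul_def]
  ext d : 1
  by_cases hd : d ∈ f.support
  · ext h
    have h1 := congrArg (MvPolynomial.coeff d) (key h)
    rw [MvPolynomial.coeff_sum] at h1
    simp only [MvPolynomial.coeff_monomial] at h1
    rw [Finset.sum_ite_eq' f.support d] at h1
    simpa [hd] using h1
  · simpa using hd

/-- There is a subring of 2-adically integral polynomials over the rational group algebra in
which integers approximate the variables arbitrarily well along a divisor chain `P`, while no
nonzero polynomial is infinitely divisible along `P`. -/
theorem exists_integral_subring [Countable J] {P : ℕ → ℕ} (hP0 : P 0 = 1)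
    (hP : ∀ n, 0 < P n) (hdvd : ∀ n, P n ∣ P (n + 1)) (htwo : ∀ n, 2 ^ n ∣ P n) :
    ∃ (S : Subring (MvPolynomial J (MonoidAlgebra ℚ H))) (a : J → ℕ → ℤ),
      (∀ r : MonoidAlgebra ℤ H,
        MvPolynomial.C (MonoidAlgebra.mapRingHom H (algebraMap ℤ ℚ) r) ∈ S) ∧
      (∀ j, a j 0 = 0) ∧ (∀ j n, (P n : ℤ) ∣ a j (n + 1) - a j n) ∧
      (∀ j n, MvPolynomial.C (algebraMap ℚ _ (P n : ℚ)⁻¹) *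
        (MvPolynomial.X j - (a j n : MvPolynomial J (MonoidAlgebra ℚ H))) ∈ S) ∧
      (∀ f, (∀ n, ∃ g ∈ S, f = P n • g) → f = 0) := by
  obtain ⟨γ, hγ⟩ := exists_algebraicIndependent_padicInt J
  choose a ha0 hadvd ha using fun j => PadicInt.exists_expansion (γ j) hP0 hP hdvd
  refine ⟨(MonoidAlgebra.mapRingHom H (algebraMap ℤ_[2] ℚ_[2])).range.comap (padicEval H γ), a,
    ?_, ha0, hadvd, ?_, ?_⟩
  · intro r
    refine ⟨MonoidAlgebra.mapRingHom H (algebraMap ℤ ℤ_[2]) r, ?_⟩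
    simp only [padicEval, MvPolynomial.coe_eval₂Hom, MvPolynomial.eval₂_C]
    ext h
    simp
  · intro j n
    obtain ⟨w, hw⟩ := ha j n
    refine ⟨algebraMap _ _ w, ?_⟩
    have hPn : (P n : ℚ_[2]) ≠ 0 := by exact_mod_cast (hP n).ne'
    have hw' : (γ j : ℚ_[2]) - a j n = P n * w := by
      exact_mod_cast congrArg ((↑) : ℤ_[2] → ℚ_[2]) hw
    have h1 : (w : ℚ_[2]) = (P n : ℚ_[2])⁻¹ * ((γ j : ℚ_[2]) - a j n) := by
      rw [hw', inv_mul_cancel_left₀ hPn]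
    have h2 : MonoidAlgebra.mapRingHom H (algebraMap ℤ_[2] ℚ_[2]) (algebraMap _ _ w)
        = algebraMap ℚ_[2] (MonoidAlgebra ℚ_[2] H) w := by
      simp
    rw [h2, h1, map_mul, map_mul, map_sub, map_sub, map_intCast, map_intCast]
    simp [padicEval]
  · intro f hf
    apply padicEval_injective H hγ
    rw [map_zero]
    ext h
    rw [MonoidAlgebra.coeff_zero, Finsupp.zero_apply, ← norm_le_zero_iff]
    have hlim : Filter.Tendsto (fun n : ℕ => ((2 : ℝ)⁻¹) ^ n) Filter.atTop (nhds 0) :=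
      tendsto_pow_atTop_nhds_zero_of_lt_one (by norm_num) (by norm_num)
    refine ge_of_tendsto' hlim fun n => ?_
    obtain ⟨g, ⟨w, hw⟩, rfl⟩ := hf n
    obtain ⟨q, hq⟩ := htwo n
    have h2 : ‖(2 : ℚ_[2])‖ = 2⁻¹ := by simpa using Padic.norm_p (p := 2)
    rw [map_nsmul, ← hw, MonoidAlgebra.coeff_smul, Finsupp.smul_apply,
      MonoidAlgebra.coeff_mapRingHom, nsmul_eq_mul, hq]
    have h3 : ‖(q : ℚ_[2])‖ ≤ 1 := by
      exact_mod_cast (q : ℤ_[2]).norm_le_one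
    have h4 : ‖algebraMap ℤ_[2] ℚ_[2] (w.coeff h)‖ ≤ 1 := (w.coeff h).2
    push_cast
    rw [norm_mul, norm_mul, norm_pow, h2]
    have h5 : (0 : ℝ) ≤ 2⁻¹ ^ n := by positivity
    calc (2⁻¹ : ℝ) ^ n * ‖(q : ℚ_[2])‖ * ‖algebraMap ℤ_[2] ℚ_[2] (w.coeff h)‖
        ≤ 2⁻¹ ^ n * 1 * 1 := by gcongr
      _ = 2⁻¹ ^ n := by ring

end IntegralSubring

/-! ### Units of integral group rings -/

theorem MonoidAlgebra.exists_eq_of_mul_eq_one {H : Type} [CommGroup H] [TwoUniqueProds H]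
    {r r' : MonoidAlgebra ℤ H} (h : r * r' = 1) :
    ∃ (ε : ℤˣ) (k : H), r = (ε : ℤ) • MonoidAlgebra.of ℤ H k := by
  classical
  have hr : r ≠ 0 := by rintro rfl; simp at h
  have hr' : r' ≠ 0 := by rintro rfl; simp at h
  -- Otherwise two different products would occur with nonzero coefficient in `1`.
  have hcard : r.coeff.support.card * r'.coeff.support.card ≤ 1 := by
    by_contra! hlt
    obtain ⟨p, hp, q, hq, hpq, hup, huq⟩ := TwoUniqueProds.uniqueMul_of_one_lt_card hlt
    simp only [Finset.mem_product, Finsupp.mem_support_iff] at hp hq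
    have h1 : ∀ x : H, ((1 : MonoidAlgebra ℤ H).coeff x ≠ 0 → x = 1) := by
      intro x hx
      by_contra hne
      exact hx (by simp [MonoidAlgebra.one_def, Ne.symm hne])
    have e1 := coeff_mul_mul_of_uniqueMul hup
    have e2 := coeff_mul_mul_of_uniqueMul huq
    have f1 : p.1 * p.2 = 1 := h1 _ (by rw [← h, e1]; exact mul_ne_zero hp.1 hp.2)
    have f2 : q.1 * q.2 = 1 := h1 _ (by rw [← h, e2]; exact mul_ne_zero hq.1 hq.2)
    have := hup (a := q.1) (b := q.2) (by simpa using hq.1) (by simpa using hq.2) (f2.trans f1.symm)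
    exact hpq (Prod.ext this.1.symm this.2.symm)
  have hc0 : r.coeff.support.card ≠ 0 := by
    simp only [ne_eq, Finset.card_eq_zero, Finsupp.support_eq_empty]
    exact fun h0 => hr (MonoidAlgebra.ext h0)
  have hc0' : r'.coeff.support.card ≠ 0 := by
    simp only [ne_eq, Finset.card_eq_zero, Finsupp.support_eq_empty]
    exact fun h0 => hr' (MonoidAlgebra.ext h0)
  have hc1 : r.coeff.support.card = 1 := by
    nlinarith [Nat.pos_of_ne_zero hc0, Nat.pos_of_ne_zero hc0']
  obtain ⟨k, ε, -, hk⟩ := Finsupp.card_support_eq_one'.mp hc1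
  have hrk : r = MonoidAlgebra.single k ε := MonoidAlgebra.ext hk
  have hε : IsUnit ε := by
    have h2 := congrArg (MonoidAlgebra.lift ℤ ℤ H (1 : H →* ℤ)) h
    rw [map_mul, hrk, map_one (MonoidAlgebra.lift ℤ ℤ H (1 : H →* ℤ)),
      MonoidAlgebra.lift_single] at h2
    simp only [MonoidHom.one_apply, smul_eq_mul, mul_one] at h2
    exact IsUnit.of_mul_eq_one _ h2
  obtain ⟨ε, rfl⟩ := hε
  exact ⟨ε, k, by rw [hrk]; simp [MonoidAlgebra.of_apply]⟩

/-! ### Binary sequences as numbers -/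

/-- The number whose binary digits, the least significant first, form the sequence `y`.
Appending `0` does not change it, appending `1` to a sequence of length `n` adds `2 ^ n`. -/
def binaryCode {n : ℕ} (y : Fin n → Bool) : ℕ := ∑ j, (y j).toNat * 2 ^ (j : ℕ)

theorem binaryCode_snoc {n : ℕ} (y : Fin n → Bool) (ε : Bool) :
    binaryCode (Fin.snoc y ε : Fin (n + 1) → Bool) = binaryCode y + ε.toNat * 2 ^ n := by
  simp [binaryCode, Fin.sum_univ_castSucc]

theorem binaryCode_lt {n : ℕ} (y : Fin n → Bool) : binaryCode y < 2 ^ n := by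
  induction n with
  | zero => simp [binaryCode]
  | succ n ih =>
    rw [← Fin.snoc_init_self y, binaryCode_snoc, pow_succ]
    have := ih (Fin.init y)
    cases y (Fin.last n) <;> simp <;> omega

theorem binaryCode_injective (n : ℕ) :
    Function.Injective (binaryCode : (Fin n → Bool) → ℕ) := by
  induction n with
  | zero => exact Function.injective_of_subsingleton _
  | succ n ih =>
    intro y y' hyy
    rw [← Fin.snoc_init_self y, ← Fin.snoc_init_self y'] at hyy ⊢
    rw [binaryCode_snoc, binaryCode_snoc] at hyy
    have h1 := binaryCode_lt (Fin.init y)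
    have h2 := binaryCode_lt (Fin.init y')
    generalize y (Fin.last n) = ε at *
    generalize y' (Fin.last n) = ε' at *
    cases ε <;> cases ε' <;> simp at hyy <;> first | omega | (rw [ih hyy])

theorem sum_snoc {M : Type*} [AddCommMonoid M] {n : ℕ} (f : (Fin (n + 1) → Bool) → M) :
    ∑ y, f y = ∑ y : Fin n → Bool, (f (Fin.snoc y false) + f (Fin.snoc y true)) := by
  rw [← (Fin.snocEquiv (fun _ => Bool)).sum_comp, Fintype.sum_prod_type, Fintype.sum_bool, add_comm,
    ← Finset.sum_add_distrib]
  rfl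

/-! ### The construction -/

/-- The data from which the module is built, over an abstract commutative ring `R` (the integral
group ring) embedded in a `ℚ`-algebra `A` (the rational group ring): the group elements
`u k ∈ R`, with `u o = 1`; an enumeration `(h i, b i)` of all pairs of a group element and a
natural number, with `b i < 2 ^ i`, where only the indices `i ≥ 1` count; the multipliers `s`,
`t`; and a subring `S` of `A[X_j]` in which the integers `a j n` approximate the variable `X_j`
modulo `s 0 * t 0 * ⋯ * s (n - 1) * t (n - 1)`, and whose topology given by the multiples of these numbers
is separated. Two variables are used for each `i`, hence the index set `ℕ × Bool`. -/
structure CornerData (R A H : Type) [CommRing R] [CommRing A] [Algebra R A] [Algebra ℚ A] where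
  u : H → R
  isUnit_u : ∀ k, IsUnit (u k)
  closure_u : AddSubgroup.closure (Set.range u) = ⊤
  o : H
  u_o : u o = 1
  h : ℕ → H
  b : ℕ → ℕ
  b_lt : ∀ i, b i < 2 ^ i
  exists_index : ∀ v k, ∃ i, 1 ≤ i ∧ b i = v ∧ h i = k
  s : ℕ → ℕ
  t : ℕ → ℕ
  s_pos : ∀ n, 0 < s n
  t_pos : ∀ n, 0 < t n
  t_dvd : ∀ n, t n ∣ s n
  S : Subring (MvPolynomial (ℕ × Bool) A)
  algebraMap_mem : ∀ r : R, algebraMap R (MvPolynomial (ℕ × Bool) A) r ∈ S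
  a : ℕ × Bool → ℕ → ℤ
  a_zero : ∀ j, a j 0 = 0
  a_dvd : ∀ j n, ((∏ m ∈ Finset.range n, s m * t m : ℕ) : ℤ) ∣ a j (n + 1) - a j n
  tail_mem : ∀ j n, MvPolynomial.C (algebraMap ℚ A ((∏ m ∈ Finset.range n, s m * t m : ℕ) : ℚ)⁻¹) *
        (MvPolynomial.X j - (a j n : MvPolynomial (ℕ × Bool) A)) ∈ S
  eq_zero : ∀ f, (∀ n, ∃ g ∈ S, f = (∏ m ∈ Finset.range n, s m * t m) • g) → f = 0
  algebraMap_injective : Function.Injective (algebraMap R A)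

namespace CornerData

variable {R A H : Type} [CommRing R] [CommRing A] [Algebra R A] [Algebra ℚ A]
  (D : CornerData R A H)

/-- The divisor chain `P n = s 0 * t 0 * ⋯ * s (n - 1) * t (n - 1)`. -/
def P (n : ℕ) : ℕ := ∏ m ∈ Finset.range n, D.s m * D.t m

theorem P_succ (n : ℕ) : D.P (n + 1) = D.P n * (D.s n * D.t n) := Finset.prod_range_succ _ _

theorem P_zero : D.P 0 = 1 := Finset.prod_range_zero _

theorem P_pos (n : ℕ) : 0 < D.P n :=
  Finset.prod_pos fun m _ => Nat.mul_pos (D.s_pos m) (D.t_pos m)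

/-- The support `{1, h i}` of the `i`-th relation. -/
noncomputable def F (i : ℕ) : Finset H := by
  classical exact {D.o, D.h i}

/-- The standard basis vectors of the free `A[X_j]`-module `ℕ →₀ A[X_j]`. -/
noncomputable def e (_ : CornerData R A H) (v : ℕ) : ℕ →₀ MvPolynomial (ℕ × Bool) A :=
  Finsupp.single v 1

/-- The element identified with the binary sequence of length `n` and code `v`. -/
noncomputable def seqNat (n v : ℕ) : ℕ →₀ MvPolynomial (ℕ × Bool) A :=
  D.e v - ∑ m ∈ Finset.range n, if v < 2 ^ m then (D.s m ^ 2) • D.e (v + 2 ^ m) else 0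

/-- The element identified with a binary sequence. -/
noncomputable def seq (n : ℕ) (y : Fin n → Bool) : ℕ →₀ MvPolynomial (ℕ × Bool) A :=
  D.seqNat n (binaryCode y)

/-- The `n`-th tail `(X_j - a j n) / P n` of the variable `X_j`. -/
noncomputable def tail (j : ℕ × Bool) (n : ℕ) : MvPolynomial (ℕ × Bool) A :=
  MvPolynomial.C (algebraMap ℚ A (D.P n : ℚ)⁻¹) *
    (MvPolynomial.X j - (D.a j n : MvPolynomial (ℕ × Bool) A))

/-- The `n`-th tail of the element `X_{i,0} e_0 + X_{i,1} x_{h i} e_{b i}`, which forces an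
endomorphism to act on `e_0` and on `x_{h i} e_{b i}` by the same scalar. -/
noncomputable def gen (i n : ℕ) : ℕ →₀ MvPolynomial (ℕ × Bool) A :=
  Finsupp.single 0 (D.tail (i, false) n) + D.u (D.h i) • Finsupp.single (D.b i) (D.tail (i, true) n)

/-! ### Binary sequences in the module -/

theorem seq_snoc_true {n : ℕ} (y : Fin n → Bool) :
    D.seq (n + 1) (Fin.snoc y true) = D.e (binaryCode y + 2 ^ n) := by
  have h0 : ∀ m ∈ Finset.range (n + 1), ¬ binaryCode y + 2 ^ n < 2 ^ m := by
    intro m hm hlt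
    have := Nat.pow_le_pow_right two_pos (Nat.lt_succ_iff.mp (Finset.mem_range.mp hm))
    omega
  rw [seq, seqNat, binaryCode_snoc]
  simp only [Bool.toNat_true, one_mul]
  rw [Finset.sum_eq_zero fun m hm => if_neg (h0 m hm), sub_zero]

theorem seq_eq {n : ℕ} (y : Fin n → Bool) :
    D.seq n y = D.seq (n + 1) (Fin.snoc y false) +
      (D.s n ^ 2) • D.seq (n + 1) (Fin.snoc y true) := by
  rw [seq_snoc_true, seq, seq, seqNat, seqNat, binaryCode_snoc, Finset.sum_range_succ]
  simp only [binaryCode_lt y, Bool.toNat_false, zero_mul, add_zero, if_true]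
  abel

theorem seq_zero (y : Fin 0 → Bool) : D.seq 0 y = D.e 0 := by
  simp [seq, seqNat, binaryCode]

/-! ### Integral combinations of sequences -/

/-- `D.IsComb F n w` says that `w` is an integral combination of the elements `x_k y`, with `k ∈ F`
and `y` a sequence of length `n`. -/
def IsComb (F : Finset H) (n : ℕ) (w : ℕ →₀ MvPolynomial (ℕ × Bool) A) : Prop :=
  ∃ N : H → (Fin n → Bool) → ℤ, w = ∑ k ∈ F, ∑ y, N k y • D.u k • D.seq n y

variable {D}

theorem IsComb.zero (F : Finset H) (n : ℕ) : D.IsComb F n 0 := ⟨0, by simp⟩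

theorem IsComb.add {F : Finset H} {n : ℕ} {w w' : ℕ →₀ MvPolynomial (ℕ × Bool) A}
    (hw : D.IsComb F n w) (hw' : D.IsComb F n w') : D.IsComb F n (w + w') := by
  obtain ⟨N, rfl⟩ := hw
  obtain ⟨N', rfl⟩ := hw'
  exact ⟨N + N', by simp [add_smul, Finset.sum_add_distrib]⟩

theorem IsComb.zsmul {F : Finset H} {n : ℕ} {w : ℕ →₀ MvPolynomial (ℕ × Bool) A}
    (hw : D.IsComb F n w) (z : ℤ) : D.IsComb F n (z • w) := by
  obtain ⟨N, rfl⟩ := hw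
  exact ⟨z • N, by simp [mul_smul, Finset.smul_sum]⟩

theorem IsComb.smul_seq {F : Finset H} {k : H} (hk : k ∈ F) {n : ℕ} (y : Fin n → Bool) :
    D.IsComb F n (D.u k • D.seq n y) := by
  classical
  refine ⟨fun k' y' => if k' = k then if y' = y then 1 else 0 else 0, ?_⟩
  rw [Finset.sum_eq_single_of_mem k hk (by intro k' _ hk'; simp [hk'])]
  rw [Finset.sum_eq_single_of_mem y (Finset.mem_univ _) (by intro y' _ hy'; simp [hy'])]
  simp

/-- Division with remainder by `s n * t n` pushes an integral combination of sequences of length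
`n` to length `n + 1`. It works because `t n` divides `s n`, so that `s n * t n` divides the factor
`s n ^ 2` of the sequences ending in `1`. -/
theorem IsComb.step {F : Finset H} {n : ℕ} {w : ℕ →₀ MvPolynomial (ℕ × Bool) A}
    (hw : D.IsComb F n w) :
    ∃ N : H → (Fin n → Bool) → ℤ, (∀ k y, 0 ≤ N k y ∧ N k y < (D.s n : ℤ) * (D.t n : ℤ)) ∧
      ∃ w', D.IsComb F (n + 1) w' ∧
        w = (D.s n * D.t n) • w' +
          ∑ k ∈ F, ∑ y, N k y • D.u k • D.seq (n + 1) (Fin.snoc y false) := by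
  obtain ⟨N, rfl⟩ := hw
  obtain ⟨q, hq⟩ := D.t_dvd n
  have hpos : 0 < (D.s n : ℤ) * (D.t n : ℤ) := by
    exact_mod_cast Nat.mul_pos (D.s_pos n) (D.t_pos n)
  refine ⟨fun k y => N k y % (D.s n * D.t n), fun k y => ⟨Int.emod_nonneg _ hpos.ne',
    Int.emod_lt_of_pos _ hpos⟩, ?_⟩
  refine ⟨_, ⟨fun k y' => if y' (Fin.last n) then q * N k (Fin.init y') else
    N k (Fin.init y') / (D.s n * D.t n), rfl⟩, ?_⟩
  rw [Finset.smul_sum, ← Finset.sum_add_distrib]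
  refine Finset.sum_congr rfl fun k _ => ?_
  rw [sum_snoc, Finset.smul_sum, ← Finset.sum_add_distrib]
  refine Finset.sum_congr rfl fun y _ => ?_
  simp only [Fin.snoc_last, Fin.init_snoc, if_true, Bool.false_eq_true, if_false]
  rw [seq_eq, smul_add, smul_add, smul_add, ← natCast_zsmul (_ : ℕ →₀ _) (D.s n * D.t n),
    ← natCast_zsmul (_ : ℕ →₀ _) (D.s n * D.t n), smul_smul, smul_smul,
    smul_comm (D.u k) (D.s n ^ 2), ← natCast_zsmul (_ : ℕ →₀ _) (D.s n ^ 2), smul_smul]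
  have h1 : ((D.s n * D.t n : ℕ) : ℤ) * (q * N k y) = N k y * ((D.s n ^ 2 : ℕ) : ℤ) := by
    rw [hq]; push_cast; ring
  have h2 := Int.emod_add_mul_ediv (N k y) (D.s n * D.t n)
  rw [h1, add_right_comm, ← add_smul]
  congr 2
  push_cast
  linarith

theorem IsComb.succ {F : Finset H} {n : ℕ} {w : ℕ →₀ MvPolynomial (ℕ × Bool) A}
    (hw : D.IsComb F n w) : D.IsComb F (n + 1) w := by
  obtain ⟨N, rfl⟩ := hw
  refine ⟨fun k y' => if y' (Fin.last n) then (D.s n ^ 2 : ℕ) * N k (Fin.init y') else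
    N k (Fin.init y'), ?_⟩
  refine Finset.sum_congr rfl fun k _ => ?_
  rw [sum_snoc]
  refine Finset.sum_congr rfl fun y _ => ?_
  simp only [Fin.snoc_last, Fin.init_snoc, if_true, Bool.false_eq_true, if_false]
  rw [seq_eq, smul_add, smul_add, smul_comm (D.u k) (D.s n ^ 2),
    ← natCast_zsmul (_ : ℕ →₀ _) (D.s n ^ 2), smul_smul, mul_comm (N k y)]

theorem IsComb.smul_e {F : Finset H} {k : H} (hk : k ∈ F) {n v : ℕ} (hv : v < 2 ^ n) :
    D.IsComb F n (D.u k • D.e v) := by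
  suffices hs : (D.IsComb F n (D.u k • D.e v)) ∧ ∃ y : Fin n → Bool, binaryCode y = v from hs.1
  induction n generalizing v with
  | zero =>
    obtain rfl : v = 0 := by simpa using hv
    exact ⟨D.seq_zero Fin.elim0 ▸ IsComb.smul_seq hk _, Fin.elim0, by simp [binaryCode]⟩
  | succ n ih =>
    by_cases hvn : v < 2 ^ n
    · obtain ⟨h1, y, rfl⟩ := ih hvn
      exact ⟨h1.succ, Fin.snoc y false, by simp [binaryCode_snoc]⟩
    · rw [pow_succ] at hv
      obtain ⟨-, y, hy⟩ := ih (v := v - 2 ^ n) (by omega)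
      have hv' : v = binaryCode y + 2 ^ n := by omega
      refine ⟨?_, Fin.snoc y true, by simp [binaryCode_snoc, hv']⟩
      rw [hv', ← seq_snoc_true]
      exact IsComb.smul_seq hk _

variable (D)

theorem o_mem (i : ℕ) : D.o ∈ D.F i := by simp [F]

theorem h_mem (i : ℕ) : D.h i ∈ D.F i := by simp [F]

theorem tail_succ (j : ℕ × Bool) (n : ℕ) :
    ∃ d : ℤ, D.tail j n = (d : MvPolynomial (ℕ × Bool) A) + (D.s n * D.t n) • D.tail j (n + 1) := by
  obtain ⟨d, hd⟩ := D.a_dvd j n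
  refine ⟨d, ?_⟩
  have hP : (D.P n : ℚ) ≠ 0 := by exact_mod_cast (D.P_pos n).ne'
  have hst : ((D.s n * D.t n : ℕ) : ℚ) ≠ 0 := by
    exact_mod_cast (Nat.mul_pos (D.s_pos n) (D.t_pos n)).ne'
  change _ = (D.P n : ℤ) * d at hd
  have hd' : (D.a j (n + 1) : MvPolynomial (ℕ × Bool) A) = D.a j n + (D.P n : ℕ) * d := by
    rw [eq_add_of_sub_eq' hd]; push_cast; ring
  set f : ℚ →+* MvPolynomial (ℕ × Bool) A := MvPolynomial.C.comp (algebraMap ℚ A) with hf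
  have e1 : f (D.P n : ℚ)⁻¹ * (D.P n : MvPolynomial (ℕ × Bool) A) = 1 := by
    rw [← map_natCast f, ← map_mul, inv_mul_cancel₀ hP, map_one]
  have e2 : f (D.P n : ℚ)⁻¹ = ((D.s n * D.t n : ℕ) : MvPolynomial (ℕ × Bool) A) *
      f (D.P (n + 1) : ℚ)⁻¹ := by
    rw [← map_natCast f, ← map_mul, P_succ, Nat.cast_mul (D.P n), mul_inv,
      mul_left_comm, mul_inv_cancel₀ hst, mul_one]
  have e3 : ∀ m, D.tail j m = f (D.P m : ℚ)⁻¹ *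
      (MvPolynomial.X j - (D.a j m : MvPolynomial (ℕ × Bool) A)) :=
    fun _ => rfl
  rw [e3, e3, hd', nsmul_eq_mul, ← mul_assoc, ← e2]
  linear_combination (d : MvPolynomial (ℕ × Bool) A) * e1

theorem tail_zero (j : ℕ × Bool) : D.tail j 0 = MvPolynomial.X j := by
  simp [tail, P_zero, D.a_zero]

theorem X_eq (j : ℕ × Bool) (n : ℕ) :
    ∃ d : ℤ, MvPolynomial.X j = (d : MvPolynomial (ℕ × Bool) A) + D.P n • D.tail j n := by
  induction n with
  | zero => exact ⟨0, by simp [tail_zero, P_zero]⟩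
  | succ n ih =>
    obtain ⟨d, hd⟩ := ih
    obtain ⟨d', hd'⟩ := D.tail_succ j n
    refine ⟨d + D.P n * d', ?_⟩
    rw [hd, hd', P_succ]
    simp only [nsmul_eq_mul]
    push_cast
    ring

theorem single_intCast_add (v : ℕ) (d : ℤ) (q : ℕ) (f : MvPolynomial (ℕ × Bool) A) :
    Finsupp.single v ((d : MvPolynomial (ℕ × Bool) A) + q • f) =
      d • D.e v + q • Finsupp.single v f := by
  rw [Finsupp.single_add, e, Finsupp.smul_single, Finsupp.smul_single, zsmul_one]

theorem gen_succ (i n : ℕ) : ∃ d d' : ℤ, D.gen i n =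
    d • D.e 0 + d' • D.u (D.h i) • D.e (D.b i) + (D.s n * D.t n) • D.gen i (n + 1) := by
  obtain ⟨d, hd⟩ := D.tail_succ (i, false) n
  obtain ⟨d', hd'⟩ := D.tail_succ (i, true) n
  refine ⟨d, d', ?_⟩
  rw [gen, hd, hd', D.single_intCast_add, D.single_intCast_add, gen, smul_add, smul_add,
    smul_comm (D.u (D.h i)) d', smul_comm (D.u (D.h i)) (D.s n * D.t n)]
  abel

theorem gen_zero_eq (i n : ℕ) : ∃ d d' : ℤ,
    MvPolynomial.X (i, false) = (d : MvPolynomial (ℕ × Bool) A) + D.P n • D.tail (i, false) n ∧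
    MvPolynomial.X (i, true) = (d' : MvPolynomial (ℕ × Bool) A) + D.P n • D.tail (i, true) n ∧
    D.gen i 0 = d • D.e 0 + d' • D.u (D.h i) • D.e (D.b i) + D.P n • D.gen i n := by
  obtain ⟨d, hd⟩ := D.X_eq (i, false) n
  obtain ⟨d', hd'⟩ := D.X_eq (i, true) n
  refine ⟨d, d', hd, hd', ?_⟩
  rw [gen, tail_zero, tail_zero, hd, hd', D.single_intCast_add, D.single_intCast_add, gen, smul_add,
    smul_add, smul_comm (D.u (D.h i)) d', smul_comm (D.u (D.h i)) (D.P n)]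
  abel

/-! ### The basis elements of the second kind -/

/-- Starting from `gen i`, carrying in the division with remainder yields elements whose successive
differences have the digits demanded. -/
theorem exists_digit_sequence (i : ℕ) : ∃ c : ℕ → ℕ →₀ MvPolynomial (ℕ × Bool) A,
    (∀ n, D.IsComb (D.F i) n (c n - D.gen i n)) ∧
    ∀ n, i ≤ n → ∃ N : H → (Fin n → Bool) → ℤ,
      (∀ k y, 0 ≤ N k y ∧ N k y < (D.s n : ℤ) * (D.t n : ℤ)) ∧
      c n - (D.s n * D.t n) • c (n + 1) =
        ∑ k ∈ D.F i, ∑ y, N k y • D.u k • D.seq (n + 1) (Fin.snoc y false) := by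
  have step : ∀ n (x : {x // D.IsComb (D.F i) n (x - D.gen i n)}),
      ∃ x' : {x // D.IsComb (D.F i) (n + 1) (x - D.gen i (n + 1))}, i ≤ n →
      ∃ N : H → (Fin n → Bool) → ℤ,
      (∀ k y, 0 ≤ N k y ∧ N k y < (D.s n : ℤ) * (D.t n : ℤ)) ∧
      x.1 - (D.s n * D.t n) • x'.1 =
        ∑ k ∈ D.F i, ∑ y, N k y • D.u k • D.seq (n + 1) (Fin.snoc y false) := by
    rintro n ⟨x, hx⟩
    by_cases hin : i ≤ n
    · obtain ⟨d, d', hd⟩ := D.gen_succ i n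
      have h0 : D.IsComb (D.F i) n (D.e 0) := by
        have := IsComb.smul_e (D := D) (D.o_mem i) (n := n) (v := 0) (by positivity)
        rwa [D.u_o, one_smul] at this
      have hb : D.IsComb (D.F i) n (D.u (D.h i) • D.e (D.b i)) :=
        IsComb.smul_e (D.h_mem i) ((D.b_lt i).trans_le (Nat.pow_le_pow_right two_pos hin))
      obtain ⟨N, hN, w', hw', he⟩ := (hx.add ((h0.zsmul d).add (hb.zsmul d'))).step
      refine ⟨⟨D.gen i (n + 1) + w', by simpa using hw'⟩, fun _ => ⟨N, hN, ?_⟩⟩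
      rw [smul_add]
      rw [hd] at he
      rw [eq_sub_of_add_eq' he.symm]
      abel
    -- For `n < i` nothing is demanded, and the carry is reset to zero.
    · exact ⟨⟨D.gen i (n + 1), by simpa using IsComb.zero (D := D) _ _⟩, fun h => absurd h hin⟩
  choose f hf using step
  let c : ∀ n, {x // D.IsComb (D.F i) n (x - D.gen i n)} := fun n =>
    Nat.rec ⟨D.gen i 0, by simpa using IsComb.zero (D := D) _ _⟩ f n
  exact ⟨fun n => (c n).1, fun n => (c n).2, fun n => hf n (c n)⟩

/-- The basis element `c_i^{(n)}`, for `1 ≤ i ≤ n`; it differs from `gen i n` by an integral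
combination of sequences of length `n`. -/
noncomputable def c (n i : ℕ) : ℕ →₀ MvPolynomial (ℕ × Bool) A :=
  (D.exists_digit_sequence i).choose n

theorem isComb_c_sub_gen (n i : ℕ) : D.IsComb (D.F i) n (D.c n i - D.gen i n) :=
  (D.exists_digit_sequence i).choose_spec.1 n

theorem c_sub_smul_c_succ {n i : ℕ} (hi : i ≤ n) : ∃ N : H → (Fin n → Bool) → ℤ,
      (∀ k y, 0 ≤ N k y ∧ N k y < (D.s n : ℤ) * (D.t n : ℤ)) ∧
      D.c n i - (D.s n * D.t n) • D.c (n + 1) i =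
        ∑ k ∈ D.F i, ∑ y, N k y • D.u k • D.seq (n + 1) (Fin.snoc y false) :=
  (D.exists_digit_sequence i).choose_spec.2 n hi

/-! ### Coefficients of the elements of the module -/

/-- The inclusion of the free `R`-module on the `e v` into the ambient module. -/
noncomputable def base (_ : CornerData R A H) :
    (ℕ →₀ R) →ₗ[R] (ℕ →₀ MvPolynomial (ℕ × Bool) A) :=
  Finsupp.mapRange.linearMap (Algebra.linearMap R _)

theorem base_apply (β : ℕ →₀ R) (v : ℕ) :
    D.base β v = MvPolynomial.C (algebraMap R A (β v)) := rfl

theorem base_single (v : ℕ) (r : R) : D.base (Finsupp.single v r) = r • D.e v := by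
  ext w : 1
  rw [base_apply, Finsupp.smul_apply, e, Finsupp.single_apply, Finsupp.single_apply]
  split_ifs
  · rw [Algebra.smul_def, mul_one]; rfl
  · simp

theorem base_injective : Function.Injective D.base := by
  intro β β' h
  ext v
  have := DFunLike.congr_fun h v
  rw [base_apply, base_apply] at this
  exact D.algebraMap_injective (MvPolynomial.C_injective _ _ this)

theorem e_mem_range (v : ℕ) : D.e v ∈ LinearMap.range D.base :=
  ⟨Finsupp.single v 1, by rw [base_single, one_smul]⟩

theorem seq_mem_range (n : ℕ) (y : Fin n → Bool) : D.seq n y ∈ LinearMap.range D.base := by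
  refine Submodule.sub_mem _ (D.e_mem_range _) (Submodule.sum_mem _ fun m _ => ?_)
  split_ifs
  · exact nsmul_mem (D.e_mem_range _) _
  · exact zero_mem _

variable {D} in
theorem IsComb.mem_of_seq_mem {F : Finset H} {n : ℕ} {w : ℕ →₀ MvPolynomial (ℕ × Bool) A}
    (hw : D.IsComb F n w) {M : Submodule R (ℕ →₀ MvPolynomial (ℕ × Bool) A)}
    (hM : ∀ y, D.seq n y ∈ M) : w ∈ M := by
  obtain ⟨N, rfl⟩ := hw
  exact sum_mem fun k _ => sum_mem fun y _ => zsmul_mem (M.smul_mem _ (hM y)) _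

/-- The sequences of length `n` are unitriangular over the basis `e v`. -/
theorem seqNat_apply_of_le {n v w : ℕ} (h : w ≤ v) : D.seqNat n v w = if w = v then 1 else 0 := by
  rw [seqNat, Finsupp.sub_apply, Finsupp.finsetSum_apply, Finset.sum_eq_zero, sub_zero, e,
    Finsupp.single_apply]
  · simp only [eq_comm]
  · intro m _
    have := Nat.two_pow_pos m
    split_ifs
    · rw [Finsupp.smul_apply, e, Finsupp.single_apply, if_neg (by omega), smul_zero]
    · rfl

theorem coeff_base {m : ℕ × Bool →₀ ℕ} (hm : m ≠ 0) (β : ℕ →₀ R) (v : ℕ) :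
    (D.base β v).coeff m = 0 := by
  rw [base_apply, MvPolynomial.coeff_C, if_neg hm.symm]

theorem coeff_tail {m : ℕ × Bool →₀ ℕ} (hm : m ≠ 0) (j : ℕ × Bool) (n : ℕ) :
    (D.tail j n).coeff m =
      if Finsupp.single j 1 = m then algebraMap ℚ A (D.P n : ℚ)⁻¹ else 0 := by
  classical
  rw [tail, MvPolynomial.coeff_C_mul, MvPolynomial.coeff_sub, MvPolynomial.coeff_X,
    ← map_intCast (MvPolynomial.C (σ := ℕ × Bool) (R := A)), MvPolynomial.coeff_C,
    if_neg hm.symm, sub_zero]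
  split_ifs <;> simp

theorem gen_apply (i n v : ℕ) : D.gen i n v = (if v = 0 then D.tail (i, false) n else 0) +
    D.u (D.h i) • (if v = D.b i then D.tail (i, true) n else 0) := by
  rw [gen, Finsupp.add_apply, Finsupp.smul_apply, Finsupp.single_apply, Finsupp.single_apply]
  simp only [eq_comm]

theorem coeff_gen_false (i k n v : ℕ) : (D.gen k n v).coeff (Finsupp.single (i, false) 1) =
    if k = i then (if v = 0 then algebraMap ℚ A (D.P n : ℚ)⁻¹ else 0) else 0 := by
  have h0 : (Finsupp.single (i, false) 1 : ℕ × Bool →₀ ℕ) ≠ 0 := by simp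
  rw [gen_apply, MvPolynomial.coeff_add, MvPolynomial.coeff_smul, apply_ite (MvPolynomial.coeff _),
    apply_ite (MvPolynomial.coeff _), D.coeff_tail h0, D.coeff_tail h0]
  simp only [Finsupp.single_left_inj one_ne_zero, Prod.mk.injEq]
  split_ifs <;> simp_all

theorem coeff_gen_true (i k n v : ℕ) : (D.gen k n v).coeff (Finsupp.single (i, true) 1) =
    if k = i then (if v = D.b i then D.u (D.h i) • algebraMap ℚ A (D.P n : ℚ)⁻¹ else 0) else 0 := by
  have h0 : (Finsupp.single (i, true) 1 : ℕ × Bool →₀ ℕ) ≠ 0 := by simp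
  rw [gen_apply, MvPolynomial.coeff_add, MvPolynomial.coeff_smul, apply_ite (MvPolynomial.coeff _),
    apply_ite (MvPolynomial.coeff _), D.coeff_tail h0, D.coeff_tail h0]
  simp only [Finsupp.single_left_inj one_ne_zero, Prod.mk.injEq]
  split_ifs <;> simp_all

theorem coeff_gen_two (j j' : ℕ × Bool) (k n v : ℕ) :
    (D.gen k n v).coeff (Finsupp.single j 1 + Finsupp.single j' 1) = 0 := by
  have h0 : (Finsupp.single j 1 + Finsupp.single j' 1 : ℕ × Bool →₀ ℕ) ≠ 0 := by simp
  have h1 : ∀ i : ℕ × Bool, (Finsupp.single i 1 : ℕ × Bool →₀ ℕ) ≠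
      Finsupp.single j 1 + Finsupp.single j' 1 := by
    intro i h
    have := congrArg Finsupp.degree h
    simp at this
  rw [gen_apply, MvPolynomial.coeff_add, MvPolynomial.coeff_smul, apply_ite (MvPolynomial.coeff _),
    apply_ite (MvPolynomial.coeff _), D.coeff_tail h0, D.coeff_tail h0, if_neg (h1 _),
    if_neg (h1 _)]
  simp

theorem smul_inv_P_eq_zero {r : R} {n : ℕ} (h : r • algebraMap ℚ A (D.P n : ℚ)⁻¹ = 0) : r = 0 := by
  have hP : (D.P n : ℚ) ≠ 0 := by exact_mod_cast (D.P_pos n).ne'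
  have h1 := congrArg (· * algebraMap ℚ A (D.P n : ℚ)) h
  simp only [Algebra.smul_def, mul_assoc, ← map_mul, inv_mul_cancel₀ hP, map_one, mul_one,
    zero_mul] at h1
  exact D.algebraMap_injective (h1.trans (map_zero _).symm)

/-! ### The module -/

/-- The prospective basis of the `n`-th submodule. -/
noncomputable def vec (n : ℕ) : (Fin n → Bool) ⊕ Set.Icc 1 n → ℕ →₀ MvPolynomial (ℕ × Bool) A :=
  Sum.elim (D.seq n) (fun i => D.c n i)

theorem c_eq_gen_add (n i : ℕ) : ∃ β, D.c n i = D.gen i n + D.base β := by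
  obtain ⟨β, hβ⟩ := (D.isComb_c_sub_gen n i).mem_of_seq_mem (D.seq_mem_range n)
  exact ⟨β, by rw [hβ]; abel⟩

theorem linearIndependent_seq (n : ℕ) : LinearIndependent R (D.seq n) := by
  rw [Fintype.linearIndependent_iff]
  intro r hr
  suffices h : ∀ v, ∀ y : Fin n → Bool, binaryCode y = v → r y = 0 from fun y => h _ y rfl
  intro v
  induction v using Nat.strong_induction_on with
  | _ v ih =>
    rintro y rfl
    have h1 := DFunLike.congr_fun hr (binaryCode y)
    rw [Finsupp.finsetSum_apply, Finset.sum_eq_single_of_mem y (Finset.mem_univ _),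
      Finsupp.smul_apply, seq, D.seqNat_apply_of_le le_rfl, if_pos rfl, Algebra.smul_def,
      mul_one] at h1
    · exact D.algebraMap_injective
        ((MvPolynomial.C_injective _ _ (h1.trans (map_zero MvPolynomial.C).symm)).trans
          (map_zero _).symm)
    · intro y' _ hy'
      rcases lt_trichotomy (binaryCode y') (binaryCode y) with hlt | heq | hgt
      · rw [ih _ hlt y' rfl, zero_smul, Finsupp.zero_apply]
      · exact absurd (binaryCode_injective n heq) hy'
      · rw [Finsupp.smul_apply, seq, D.seqNat_apply_of_le hgt.le, if_neg hgt.ne, smul_zero]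

/-- The coefficient of `X_{i,0}` at `e 0` singles out `c n i`; the sequences are unitriangular. -/
theorem linearIndependent_vec (n : ℕ) : LinearIndependent R (D.vec n) := by
  rw [Fintype.linearIndependent_iff]
  intro r hr
  rw [Fintype.sum_sum_type] at hr
  simp only [vec, Sum.elim_inl, Sum.elim_inr] at hr
  have hc : ∀ i, r (Sum.inr i) = 0 := by
    intro i
    have h0 : (Finsupp.single ((i : ℕ), false) 1 : ℕ × Bool →₀ ℕ) ≠ 0 := by simp
    have h1 := congrArg (MvPolynomial.coeff (Finsupp.single ((i : ℕ), false) 1))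
      (DFunLike.congr_fun hr 0)
    simp only [Finsupp.add_apply, Finsupp.finsetSum_apply, Finsupp.smul_apply,
      MvPolynomial.coeff_add, MvPolynomial.coeff_sum, MvPolynomial.coeff_smul,
      Finsupp.zero_apply, MvPolynomial.coeff_zero] at h1
    rw [Finset.sum_eq_zero, zero_add, Finset.sum_eq_single_of_mem i (Finset.mem_univ _)] at h1
    · obtain ⟨β, hβ⟩ := D.c_eq_gen_add n i
      rw [hβ, Finsupp.add_apply, MvPolynomial.coeff_add, D.coeff_base h0, coeff_gen_false,
        if_pos rfl, if_pos rfl, add_zero] at h1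
      exact D.smul_inv_P_eq_zero h1
    · intro k _ hk
      obtain ⟨β, hβ⟩ := D.c_eq_gen_add n k
      rw [hβ, Finsupp.add_apply, MvPolynomial.coeff_add, D.coeff_base h0, coeff_gen_false,
        if_neg (fun h => hk (Subtype.ext h)), add_zero, smul_zero]
    · intro y _
      obtain ⟨β, hβ⟩ := D.seq_mem_range n y
      rw [← hβ, D.coeff_base h0, smul_zero]
  have hy : ∀ y, r (Sum.inl y) = 0 := by
    refine Fintype.linearIndependent_iff.mp (D.linearIndependent_seq n) _ ?_
    simpa [hc] using hr
  rintro (y | i)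
  · exact hy y
  · exact hc i

theorem span_vec_mono : Monotone fun n => Submodule.span R (Set.range (D.vec n)) := by
  refine monotone_nat_of_le_succ fun n => Submodule.span_le.mpr ?_
  have hseq : ∀ y, D.seq (n + 1) y ∈ Submodule.span R (Set.range (D.vec (n + 1))) :=
    fun y => Submodule.subset_span ⟨Sum.inl y, rfl⟩
  rintro _ ⟨y | i, rfl⟩
  · change D.seq n y ∈ _
    rw [seq_eq]
    exact add_mem (hseq _) (nsmul_mem (hseq _) _)
  · change D.c n i ∈ _
    obtain ⟨N, -, hN⟩ := D.c_sub_smul_c_succ i.2.2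
    rw [sub_eq_iff_eq_add.mp hN]
    refine add_mem (sum_mem fun k _ => sum_mem fun y _ =>
      zsmul_mem (Submodule.smul_mem _ _ (hseq _)) _) (nsmul_mem (Submodule.subset_span ?_) _)
    exact ⟨Sum.inr ⟨i, i.2.1, i.2.2.trans n.le_succ⟩, rfl⟩

/-- The module, as the union of the free modules on the `vec n`. -/
noncomputable def G : Submodule R (ℕ →₀ MvPolynomial (ℕ × Bool) A) :=
  ⨆ n, Submodule.span R (Set.range (D.vec n))

variable {D} in
theorem mem_G {g : ℕ →₀ MvPolynomial (ℕ × Bool) A} :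
    g ∈ D.G ↔ ∃ n, g ∈ Submodule.span R (Set.range (D.vec n)) :=
  Submodule.mem_iSup_of_directed _ D.span_vec_mono.directed_le

theorem vec_mem (n : ℕ) (x) : D.vec n x ∈ D.G :=
  mem_G.mpr ⟨n, Submodule.subset_span ⟨x, rfl⟩⟩

theorem seq_mem (n : ℕ) (y : Fin n → Bool) : D.seq n y ∈ D.G := D.vec_mem n (Sum.inl y)

theorem e_mem (v : ℕ) : D.e v ∈ D.G := by
  have h := IsComb.smul_e (D := D) (D.o_mem 0) (n := v) (v := v) Nat.lt_two_pow_self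
  rw [D.u_o, one_smul] at h
  exact h.mem_of_seq_mem (D.seq_mem v)

theorem c_mem {n i : ℕ} (hi : 1 ≤ i) (hin : i ≤ n) : D.c n i ∈ D.G :=
  D.vec_mem n (Sum.inr ⟨i, hi, hin⟩)

theorem gen_mem {i : ℕ} (hi : 1 ≤ i) (n : ℕ) : D.gen i n ∈ D.G := by
  suffices h : ∀ k n, i ≤ n + k → D.gen i n ∈ D.G from h i n (Nat.le_add_left _ _)
  intro k
  induction k with
  | zero =>
    intro n hin
    have h := sub_mem (D.c_mem hi hin) ((D.isComb_c_sub_gen n i).mem_of_seq_mem (D.seq_mem n))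
    simpa using h
  | succ k ih =>
    intro n hin
    obtain ⟨d, d', hd⟩ := D.gen_succ i n
    rw [hd]
    exact add_mem (add_mem (zsmul_mem (D.e_mem _) _)
      (zsmul_mem (Submodule.smul_mem _ _ (D.e_mem _)) _)) (nsmul_mem (ih (n + 1) (by omega)) _)

theorem exists_eq_sum_gen {g : ℕ →₀ MvPolynomial (ℕ × Bool) A} (hg : g ∈ D.G) :
    ∃ (n : ℕ) (ρ : ℕ → R) (β : ℕ →₀ R),
      g = ∑ i ∈ Finset.Icc 1 n, ρ i • D.gen i n + D.base β := by
  obtain ⟨n, hn⟩ := mem_G.mp hg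
  refine ⟨n, ?_⟩
  clear hg
  induction hn using Submodule.span_induction with
  | mem x hx =>
    obtain ⟨y | i, rfl⟩ := hx
    · obtain ⟨β, hβ⟩ := D.seq_mem_range n y
      exact ⟨0, β, by simp [hβ, vec]⟩
    · obtain ⟨β, hβ⟩ := D.c_eq_gen_add n i
      refine ⟨Pi.single (i : ℕ) 1, β, ?_⟩
      rw [Finset.sum_eq_single_of_mem (i : ℕ) (Finset.mem_Icc.mpr i.2)
        (fun k _ hk => by rw [Pi.single_eq_of_ne hk, zero_smul]), Pi.single_eq_same, one_smul, ← hβ]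
      rfl
  | zero => exact ⟨0, 0, by simp⟩
  | add x y _ _ hx hy =>
    obtain ⟨ρ, β, rfl⟩ := hx
    obtain ⟨ρ', β', rfl⟩ := hy
    refine ⟨ρ + ρ', β + β', ?_⟩
    simp only [Pi.add_apply, add_smul, Finset.sum_add_distrib, map_add]
    abel
  | smul r x _ hx =>
    obtain ⟨ρ, β, rfl⟩ := hx
    exact ⟨r • ρ, r • β, by simp [Finset.smul_sum, mul_smul]⟩

/-- The elements of the module have degree at most one, their linear coefficients
are concentrated where those of the `gen i` are, and an element without linear coefficients lies in
the free module on the `e v`. -/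
theorem exists_coeff {g : ℕ →₀ MvPolynomial (ℕ × Bool) A} (hg : g ∈ D.G) :
    ∃ (lam : ℕ → A) (β : ℕ →₀ R),
      (∀ i v, (g v).coeff (Finsupp.single (i, false) 1) = if v = 0 then lam i else 0) ∧
      (∀ i v, (g v).coeff (Finsupp.single (i, true) 1) =
        if v = D.b i then D.u (D.h i) • lam i else 0) ∧
      (∀ j j' v, (g v).coeff (Finsupp.single j 1 + Finsupp.single j' 1) = 0) ∧
      ((∀ i, lam i = 0) → g = D.base β) := by
  obtain ⟨n, ρ, β, rfl⟩ := D.exists_eq_sum_gen hg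
  refine ⟨fun i => if i ∈ Finset.Icc 1 n then ρ i • algebraMap ℚ A (D.P n : ℚ)⁻¹ else 0, β,
    ?_, ?_, ?_, ?_⟩
  · intro i v
    have h0 : (Finsupp.single (i, false) 1 : ℕ × Bool →₀ ℕ) ≠ 0 := by simp
    simp only [Finsupp.add_apply, Finsupp.finsetSum_apply, Finsupp.smul_apply,
      MvPolynomial.coeff_add, MvPolynomial.coeff_sum, MvPolynomial.coeff_smul, coeff_gen_false,
      D.coeff_base h0, add_zero, smul_ite, smul_zero, Finset.sum_ite_eq']
    split_ifs <;> rfl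
  · intro i v
    have h0 : (Finsupp.single (i, true) 1 : ℕ × Bool →₀ ℕ) ≠ 0 := by simp
    simp only [Finsupp.add_apply, Finsupp.finsetSum_apply, Finsupp.smul_apply,
      MvPolynomial.coeff_add, MvPolynomial.coeff_sum, MvPolynomial.coeff_smul, coeff_gen_true,
      D.coeff_base h0, add_zero, smul_ite, smul_zero, Finset.sum_ite_eq']
    split_ifs
    · exact smul_comm _ _ _
    all_goals rfl
  · intro j j' v
    have h0 : (Finsupp.single j 1 + Finsupp.single j' 1 : ℕ × Bool →₀ ℕ) ≠ 0 := by simp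
    simp [MvPolynomial.coeff_sum, coeff_gen_two, D.coeff_base h0]
  · intro h
    rw [Finset.sum_eq_zero, zero_add]
    intro i hi
    have hi' := h i
    simp only [if_pos hi] at hi'
    rw [D.smul_inv_P_eq_zero hi', zero_smul]

/-! ### Integrality and reducedness -/

theorem smul_mem_S (r : R) {f : MvPolynomial (ℕ × Bool) A} (hf : f ∈ D.S) : r • f ∈ D.S := by
  rw [Algebra.smul_def]
  exact mul_mem (D.algebraMap_mem r) hf

theorem apply_mem_S {g : ℕ →₀ MvPolynomial (ℕ × Bool) A} (hg : g ∈ D.G) (v : ℕ) : g v ∈ D.S := by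
  obtain ⟨n, ρ, β, rfl⟩ := D.exists_eq_sum_gen hg
  rw [Finsupp.add_apply, Finsupp.finsetSum_apply]
  refine add_mem (sum_mem fun i _ => D.smul_mem_S _ ?_) (D.algebraMap_mem (β v))
  rw [gen_apply]
  refine add_mem ?_ (D.smul_mem_S _ ?_)
  · split_ifs
    exacts [D.tail_mem _ _, zero_mem _]
  · split_ifs
    exacts [D.tail_mem _ _, zero_mem _]

/-- The module as a type of its own, with its structures of abelian group and `R`-module fixed
once and for all. -/
def Carrier : Type := D.G

noncomputable instance : AddCommGroup D.Carrier := inferInstanceAs (AddCommGroup D.G)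

noncomputable instance : Module R D.Carrier := inferInstanceAs (Module R D.G)

/-- The inclusion of the module into the ambient free module. -/
noncomputable def incl : D.Carrier →ₗ[R] (ℕ →₀ MvPolynomial (ℕ × Bool) A) := D.G.subtype

theorem incl_injective : Function.Injective D.incl := Subtype.val_injective

theorem incl_mem (g : D.Carrier) : D.incl g ∈ D.G := g.2

/-- The element of the module with a given image in the ambient module. -/
def elt (w : ℕ →₀ MvPolynomial (ℕ × Bool) A) (hw : w ∈ D.G) : D.Carrier := ⟨w, hw⟩

@[simp] theorem incl_elt (w : ℕ →₀ MvPolynomial (ℕ × Bool) A) (hw : w ∈ D.G) :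
    D.incl (D.elt w hw) = w := rfl

theorem eq_zero_of_forall_dvd {g : D.Carrier} (h : ∀ n, ∃ g' : D.Carrier, g = D.P n • g') :
    g = 0 := by
  apply D.incl_injective
  ext v : 1
  rw [map_zero]
  refine D.eq_zero _ fun n => ?_
  obtain ⟨g', hg'⟩ := h n
  exact ⟨D.incl g' v, D.apply_mem_S (D.incl_mem g') v, by
    rw [hg', map_nsmul, Finsupp.smul_apply]; rfl⟩

theorem isReducedAddGroup : IsReducedAddGroup D.Carrier := by
  rintro E ⟨hE⟩
  rw [eq_bot_iff]
  intro g hg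
  rw [AddSubgroup.mem_bot]
  refine D.eq_zero_of_forall_dvd fun n => ?_
  have h := DivisibleBy.div_cancel (⟨g, hg⟩ : E) (n := (D.P n : ℤ))
    (by exact_mod_cast (D.P_pos n).ne')
  refine ⟨(DivisibleBy.div (⟨g, hg⟩ : E) (D.P n : ℤ) : E), ?_⟩
  have h' := congrArg (Subtype.val : E → D.Carrier) h
  rw [← natCast_zsmul]
  exact h'.symm

/-! ### Endomorphisms -/

/-- An endomorphism is continuous for the topology given by the subgroups `P n • G`, hence it
commutes with the substitution of the variables in `gen i 0`, which are limits of integers. -/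
theorem map_gen_apply (φ : D.Carrier →+ D.Carrier) {i : ℕ} (hi : 1 ≤ i) (v : ℕ) :
    D.incl (φ (D.elt _ (D.gen_mem hi 0))) v =
      MvPolynomial.X (i, false) * D.incl (φ (D.elt _ (D.e_mem 0))) v +
      MvPolynomial.X (i, true) * D.incl (φ (D.u (D.h i) • D.elt _ (D.e_mem (D.b i)))) v := by
  rw [← sub_eq_zero]
  refine D.eq_zero _ fun n => ?_
  obtain ⟨d, d', hd, hd', hg⟩ := D.gen_zero_eq i n
  have h1 : D.elt _ (D.gen_mem hi 0) = d • D.elt _ (D.e_mem 0) +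
      d' • D.u (D.h i) • D.elt _ (D.e_mem (D.b i)) + D.P n • D.elt _ (D.gen_mem hi n) :=
    D.incl_injective (by simpa using hg)
  refine ⟨D.incl (φ (D.elt _ (D.gen_mem hi n))) v -
      D.tail (i, false) n * D.incl (φ (D.elt _ (D.e_mem 0))) v -
      D.tail (i, true) n * D.incl (φ (D.u (D.h i) • D.elt _ (D.e_mem (D.b i)))) v,
    sub_mem (sub_mem (D.apply_mem_S (D.incl_mem _) v)
      (mul_mem (D.tail_mem _ _) (D.apply_mem_S (D.incl_mem _) v)))
      (mul_mem (D.tail_mem _ _) (D.apply_mem_S (D.incl_mem _) v)), ?_⟩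
  rw [h1, hd, hd', map_add φ, map_add φ, map_zsmul φ, map_zsmul φ, map_nsmul φ, map_add, map_add,
    map_zsmul, map_zsmul, map_nsmul, Finsupp.add_apply, Finsupp.add_apply, Finsupp.smul_apply,
    Finsupp.smul_apply, Finsupp.smul_apply]
  change _ = D.P n • _
  simp only [zsmul_eq_mul, nsmul_eq_mul]
  ring

theorem eq_zero_of_smul_u {k : H} {x : A} (h : D.u k • x = 0) : x = 0 :=
  (D.isUnit_u k).smul_eq_zero.mp h

/-- An endomorphism multiplies all `x_k e v` by one and the same scalar. The proof
compares coefficients in `map_gen_apply`: the quadratic ones show that the images of `e 0` and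
`x_k e v` have constant coordinates, the linear ones that these are proportional. -/
theorem exists_map_u_smul_e (φ : D.Carrier →+ D.Carrier) : ∃ r : R, ∀ k v,
    φ (D.u k • D.elt _ (D.e_mem v)) = r • D.u k • D.elt _ (D.e_mem v) := by
  classical
  obtain ⟨lam', β', hf', -, -, hb'⟩ := D.exists_coeff (D.incl_mem (φ (D.elt _ (D.e_mem 0))))
  refine ⟨β' 0, fun k v => ?_⟩
  obtain ⟨i, hi, rfl, rfl⟩ := D.exists_index v k
  have key := D.map_gen_apply φ hi
  obtain ⟨lam, β, hf, ht, hq, -⟩ := D.exists_coeff (D.incl_mem (φ (D.elt _ (D.gen_mem hi 0))))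
  obtain ⟨lam'', β'', -, ht'', -, hb''⟩ :=
    D.exists_coeff (D.incl_mem (φ (D.u (D.h i) • D.elt _ (D.e_mem (D.b i)))))
  have hl' : ∀ j, lam' j = 0 := by
    intro j
    have h1 := congrArg
      (MvPolynomial.coeff (Finsupp.single (i, false) 1 + Finsupp.single (j, false) 1)) (key 0)
    rw [hq, MvPolynomial.coeff_add, MvPolynomial.coeff_X_mul, hf', if_pos rfl,
      MvPolynomial.coeff_X_mul', if_neg, add_zero] at h1
    · exact h1.symm
    · simp
  have hl'' : ∀ j, lam'' j = 0 := by
    intro j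
    have h1 := congrArg
      (MvPolynomial.coeff (Finsupp.single (i, true) 1 + Finsupp.single (j, true) 1)) (key (D.b j))
    rw [hq, MvPolynomial.coeff_add, MvPolynomial.coeff_X_mul', if_neg (by simp), zero_add,
      MvPolynomial.coeff_X_mul, ht'', if_pos rfl] at h1
    exact D.eq_zero_of_smul_u h1.symm
  replace hb' := hb' hl'
  replace hb'' := hb'' hl''
  rw [hb', hb''] at key
  -- The coefficients of `X_{i,0}` identify the scalar of `φ (gen i 0)` with that of `φ (e 0)`.
  have hlam : lam i = algebraMap R A (β' 0) := by
    have h1 := congrArg (MvPolynomial.coeff (Finsupp.single (i, false) 1)) (key 0)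
    rwa [hf, if_pos rfl, MvPolynomial.coeff_add, MvPolynomial.coeff_X_mul', if_pos (by simp),
      MvPolynomial.coeff_X_mul', if_neg (by simp), add_zero, tsub_self, base_apply,
      MvPolynomial.coeff_zero_C] at h1
  have hβ'' : β'' = Finsupp.single (D.b i) (β' 0 * D.u (D.h i)) := by
    ext w
    apply D.algebraMap_injective
    have h1 := congrArg (MvPolynomial.coeff (Finsupp.single (i, true) 1)) (key w)
    have hi0 : (i, false) ∉ (Finsupp.single (i, true) 1 : ℕ × Bool →₀ ℕ).support := by simp
    have hi1 : (i, true) ∈ (Finsupp.single (i, true) 1 : ℕ × Bool →₀ ℕ).support := by simp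
    rw [ht, MvPolynomial.coeff_add, MvPolynomial.coeff_X_mul', if_neg hi0, zero_add,
      MvPolynomial.coeff_X_mul', if_pos hi1, tsub_self, base_apply (β := β''),
      MvPolynomial.coeff_zero_C] at h1
    rw [← h1, hlam, Finsupp.single_apply]
    simp only [eq_comm (a := D.b i)]
    split_ifs
    · rw [Algebra.smul_def, map_mul, mul_comm]
    · rw [map_zero]
  apply D.incl_injective
  rw [hb'', hβ'', base_single, mul_smul, map_smul, map_smul, incl_elt]

/-- Every endomorphism of the abelian group is multiplication by a scalar. -/
theorem exists_eq_smul (φ : D.Carrier →+ D.Carrier) : ∃ r : R, ∀ g, φ g = r • g := by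
  obtain ⟨r, hr⟩ := D.exists_map_u_smul_e φ
  refine ⟨r, ?_⟩
  -- The difference `ψ` to the scalar vanishes on the `R`-span of the `e v`, and modulo that span
  -- every element is divisible by all `P n`.
  let ψ : D.Carrier →+ D.Carrier := φ - DistribSMul.toAddMonoidHom D.Carrier r
  have hψ : ∀ g, ψ g = φ g - r • g := fun _ => rfl
  suffices h : ∀ g, ψ g = 0 from fun g => sub_eq_zero.mp ((hψ g).symm.trans (h g))
  have he : ∀ (q : R) v, ψ (q • D.elt _ (D.e_mem v)) = 0 := by
    intro q v
    have hq : q ∈ AddSubgroup.closure (Set.range D.u) := D.closure_u ▸ AddSubgroup.mem_top q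
    induction hq using AddSubgroup.closure_induction with
    | mem x hx => obtain ⟨k, rfl⟩ := hx; rw [hψ, hr, sub_self]
    | zero => rw [zero_smul, map_zero]
    | add x y _ _ hx hy => rw [add_smul, map_add, hx, hy, add_zero]
    | neg x _ hx => rw [neg_smul, map_neg, hx, neg_zero]
  have hgen : ∀ (q : R) {i} (hi : 1 ≤ i) n, D.P n • ψ (q • D.elt _ (D.gen_mem hi n)) =
      ψ (q • D.elt _ (D.gen_mem hi 0)) := by
    intro q i hi n
    obtain ⟨d, d', -, -, hg⟩ := D.gen_zero_eq i n
    have h1 : q • D.elt _ (D.gen_mem hi 0) = d • q • D.elt _ (D.e_mem 0) +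
        d' • (q * D.u (D.h i)) • D.elt _ (D.e_mem (D.b i)) +
        D.P n • q • D.elt _ (D.gen_mem hi n) := by
      apply D.incl_injective
      simp only [map_add, map_smul, map_zsmul, map_nsmul, incl_elt]
      rw [hg, smul_add, smul_add, smul_comm q d, smul_comm q d', smul_comm q (D.P n), mul_smul]
    rw [h1, map_add, map_add, map_zsmul, map_zsmul, map_nsmul, he, he, smul_zero, smul_zero,
      add_zero, zero_add]
  have hgen' : ∀ (q : R) {i} (hi : 1 ≤ i) n, ψ (q • D.elt _ (D.gen_mem hi n)) = 0 := by
    intro q i hi n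
    have h0 := D.eq_zero_of_forall_dvd fun n => ⟨_, (hgen q hi n).symm⟩
    have h1 := (hgen q hi n).trans h0
    apply D.incl_injective
    have h2 := congrArg D.incl h1
    rw [map_nsmul, map_zero, ← Nat.cast_smul_eq_nsmul ℚ] at h2
    rw [map_zero]
    exact (smul_eq_zero.mp h2).resolve_left (by exact_mod_cast (D.P_pos n).ne')
  intro g
  obtain ⟨n, ρ, β, hg⟩ := D.exists_eq_sum_gen (D.incl_mem g)
  have hg' : g = ∑ i ∈ (Finset.Icc 1 n).attach,
      ρ i • D.elt _ (D.gen_mem (Finset.mem_Icc.mp i.2).1 n) +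
      β.sum fun v q => q • D.elt _ (D.e_mem v) := by
    apply D.incl_injective
    rw [map_add, map_sum, map_finsuppSum]
    simp only [map_smul, incl_elt, ← base_single]
    rw [← map_finsuppSum, Finsupp.sum_single, hg,
      Finset.sum_attach (Finset.Icc 1 n) (fun i => ρ i • D.gen i n)]
  rw [hg', map_add, map_sum, map_finsuppSum,
    Finset.sum_eq_zero fun i _ => hgen' _ (Finset.mem_Icc.mp i.2).1 _, zero_add]
  exact Finset.sum_eq_zero fun v _ => he _ _

theorem smul_injective {r r' : R} (h : ∀ g : D.Carrier, r • g = r' • g) : r = r' := by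
  have h1 := congrArg D.incl (h (D.elt _ (D.e_mem 0)))
  rw [map_smul, map_smul, incl_elt, ← base_single, ← base_single] at h1
  exact Finsupp.single_injective 0 (D.base_injective h1)

/-! ### The chain of free submodules -/

/-- The prospective basis of the `n`-th submodule, inside the module. -/
noncomputable def basisVec (n : ℕ) (x : (Fin n → Bool) ⊕ Set.Icc 1 n) : D.Carrier :=
  D.elt _ (D.vec_mem n x)

theorem linearIndependent_basisVec (n : ℕ) : LinearIndependent R (D.basisVec n) :=
  LinearIndependent.of_comp D.incl (D.linearIndependent_vec n)

/-- The `n`-th free submodule. -/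
noncomputable def chain (n : ℕ) : Submodule R D.Carrier :=
  Submodule.span R (Set.range (D.basisVec n))

/-- The basis of the `n`-th free submodule. -/
noncomputable def chainBasis (n : ℕ) :
    Module.Basis ((Fin n → Bool) ⊕ Set.Icc 1 n) R (D.chain n) :=
  Module.Basis.span (D.linearIndependent_basisVec n)

theorem coe_chainBasis (n : ℕ) (x) : (D.chainBasis n x : D.Carrier) = D.basisVec n x :=
  congrArg Subtype.val (Module.Basis.span_apply (D.linearIndependent_basisVec n) x)

theorem mem_chain {n : ℕ} {g : D.Carrier} :
    g ∈ D.chain n ↔ D.incl g ∈ Submodule.span R (Set.range (D.vec n)) := by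
  have h : Set.range (D.vec n) = D.incl '' Set.range (D.basisVec n) := by
    rw [← Set.range_comp]
    rfl
  rw [h, Submodule.span_image, Submodule.mem_map]
  exact ⟨fun hg => ⟨g, hg, rfl⟩, fun ⟨g', hg', he⟩ => D.incl_injective he ▸ hg'⟩

theorem chain_mono : Monotone D.chain :=
  fun _ _ h _ hg => D.mem_chain.mpr (D.span_vec_mono h (D.mem_chain.mp hg))

theorem iUnion_chain : (⋃ n, (D.chain n : Set D.Carrier)) = Set.univ := by
  refine Set.eq_univ_of_forall fun g => Set.mem_iUnion.mpr ?_
  obtain ⟨n, hn⟩ := mem_G.mp (D.incl_mem g)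
  exact ⟨n, D.mem_chain.mpr hn⟩

end CornerData

/-! ### The group ring of a group of positive rationals -/

section GroupRing

theorem MonoidAlgebra.closure_range_of (H : Type) [CommGroup H] :
    AddSubgroup.closure (Set.range (MonoidAlgebra.of ℤ H)) = ⊤ := by
  rw [eq_top_iff]
  intro r _
  induction r using MonoidAlgebra.induction_on with
  | of k => exact AddSubgroup.subset_closure ⟨k, rfl⟩
  | add x y hx hy => exact add_mem (hx trivial) (hy trivial)
  | smul z x hx => exact zsmul_mem (hx trivial) z

/-- A countable set of pairs `(v, k)` can be enumerated so that the first component of the `i`-th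
pair is less than `2 ^ i`. -/
theorem exists_enumeration (H : Type) [Countable H] [Inhabited H] : ∃ p : ℕ → ℕ × H,
    (∀ i, (p i).1 < 2 ^ i) ∧ ∀ v k, ∃ i, 1 ≤ i ∧ p i = (v, k) := by
  obtain ⟨f, hf⟩ := exists_surjective_nat (ℕ × H)
  refine ⟨fun i => if (f i.unpair.1).1 < 2 ^ i then f i.unpair.1 else (0, default), fun i => ?_,
    fun v k => ?_⟩
  · dsimp only
    split_ifs with h
    exacts [h, by positivity]
  · obtain ⟨m, hm⟩ := hf (v, k)
    have h1 : v + 1 ≤ Nat.pair m (v + 1) := Nat.right_le_pair _ _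
    refine ⟨Nat.pair m (v + 1), by omega, ?_⟩
    simp only [Nat.unpair_pair, hm]
    rw [if_pos]
    exact lt_trans (by omega) Nat.lt_two_pow_self

/-- The data of the construction exist over the group ring of `H`, with `t n = n + 1` and with
`s n` growing as fast as needed for given weights of the elements of `H`. -/
theorem exists_cornerData (H : Type) [CommGroup H] [Countable H] (wt : H → ℚ) :
    ∃ (_ : Algebra (MonoidAlgebra ℤ H) (MonoidAlgebra ℚ H))
      (D : CornerData (MonoidAlgebra ℤ H) (MonoidAlgebra ℚ H) H),
      D.u = MonoidAlgebra.of ℤ H ∧ (∀ n, D.t n = n + 1) ∧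
      ∀ n, (n.factorial : ℚ) * (n + 1) * (∑ i ∈ Finset.Icc 1 n, ∑ k ∈ D.F i, wt k) + 1 ≤ D.s n := by
  classical
  have : Inhabited H := ⟨1⟩
  obtain ⟨p, hp, hp'⟩ := exists_enumeration H
  let wsum : ℕ → ℚ := fun n => (n.factorial : ℚ) * (n + 1) *
    ∑ i ∈ Finset.Icc 1 n, ∑ k ∈ ({1, (p i).2} : Finset H), wt k
  -- The factor `n + 1` makes `t n` divide `s n`, the factor `2` gives `2 ^ n ∣ P n`, and the last
  -- factor exceeds the weighted sum.
  let s : ℕ → ℕ := fun n => 2 * (n + 1) * (⌈wsum n⌉₊ + 1)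
  let t : ℕ → ℕ := fun n => n + 1
  have hs : ∀ n, 0 < s n := fun n => by positivity
  have ht : ∀ n, 0 < t n := fun n => by positivity
  have hPs : ∀ n, ∏ m ∈ Finset.range (n + 1), s m * t m =
      (∏ m ∈ Finset.range n, s m * t m) * (s n * t n) := fun n => Finset.prod_range_succ _ _
  obtain ⟨S, a, hS, ha0, ha, hS', hSz⟩ := exists_integral_subring H (J := ℕ × Bool)
    (P := fun n => ∏ m ∈ Finset.range n, s m * t m) (Finset.prod_range_zero _)
    (fun n => Finset.prod_pos fun m _ => Nat.mul_pos (hs m) (ht m))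
    (fun n => Dvd.intro _ (hPs n).symm)
    (fun n => by
      calc 2 ^ n = ∏ m ∈ Finset.range n, 2 := by simp
        _ ∣ _ := Finset.prod_dvd_prod_of_dvd _ _ fun m _ =>
          ⟨(m + 1) * (⌈wsum m⌉₊ + 1) * t m, by simp only [s]; ring⟩)
  let _ : Algebra (MonoidAlgebra ℤ H) (MonoidAlgebra ℚ H) :=
    (MonoidAlgebra.mapRingHom H (algebraMap ℤ ℚ)).toAlgebra
  refine ⟨inferInstance, {
    u := MonoidAlgebra.of ℤ H
    isUnit_u := fun k => (Group.isUnit k).map _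
    closure_u := MonoidAlgebra.closure_range_of H
    o := 1
    u_o := map_one _
    h := fun i => (p i).2
    b := fun i => (p i).1
    b_lt := hp
    exists_index := fun v k => by
      obtain ⟨i, hi, he⟩ := hp' v k
      exact ⟨i, hi, by rw [he], by rw [he]⟩
    s := s
    t := t
    s_pos := hs
    t_pos := ht
    t_dvd := fun n => ⟨2 * (⌈wsum n⌉₊ + 1), by simp only [s, t]; ring⟩
    S := S
    algebraMap_mem := hS
    a := a
    a_zero := ha0
    a_dvd := ha
    tail_mem := hS'
    eq_zero := hSz
    algebraMap_injective := ?_ }, rfl, fun _ => rfl, fun n => ?_⟩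
  · intro x y hxy
    ext k
    have h1 := DFunLike.congr_fun (congrArg MonoidAlgebra.coeff hxy) k
    change (MonoidAlgebra.mapRingHom H (algebraMap ℤ ℚ) x).coeff k =
      (MonoidAlgebra.mapRingHom H (algebraMap ℤ ℚ) y).coeff k at h1
    simpa using h1
  · have h1 : wsum n ≤ ⌈wsum n⌉₊ := Nat.le_ceil _
    have h2 : (⌈wsum n⌉₊ + 1 : ℚ) ≤ s n := by
      have : ⌈wsum n⌉₊ + 1 ≤ s n := Nat.le_mul_of_pos_left _ (by positivity)
      exact_mod_cast this
    exact (add_le_add_left h1 1).trans h2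

theorem CornerData.autEqPlusMinus {H : Type} [CommGroup H] [TwoUniqueProds H]
    [Algebra (MonoidAlgebra ℤ H) (MonoidAlgebra ℚ H)]
    (D : CornerData (MonoidAlgebra ℤ H) (MonoidAlgebra ℚ H) H) :
    AutEqPlusMinus H D.Carrier := by
  constructor
  · rintro ⟨ε, k⟩ ⟨ε', k'⟩ h
    have h1 : (ε : ℤ) • MonoidAlgebra.of ℤ H k = (ε' : ℤ) • MonoidAlgebra.of ℤ H k' := by
      refine D.smul_injective fun g => ?_
      have h2 := DFunLike.congr_fun (congrArg Multiplicative.toAdd h) g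
      rw [plusMinusAct_apply, plusMinusAct_apply] at h2
      rwa [smul_assoc, smul_assoc]
    have h2 : Finsupp.single k (ε : ℤ) = Finsupp.single k' (ε' : ℤ) := by
      simpa [MonoidAlgebra.of_apply] using congrArg MonoidAlgebra.coeff h1
    rcases (Finsupp.single_eq_single_iff _ _ _ _).mp h2 with ⟨hk, hε⟩ | ⟨hε, -⟩
    · exact Prod.ext (Units.ext hε) hk
    · exact absurd hε ε.ne_zero
  · intro φ
    obtain ⟨r, hr⟩ := D.exists_eq_smul (φ.toAdd : D.Carrier →+ D.Carrier)
    obtain ⟨r', hr'⟩ := D.exists_eq_smul (φ.toAdd.symm : D.Carrier →+ D.Carrier)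
    have hrr : r * r' = 1 := D.smul_injective fun g => by
      rw [mul_smul, one_smul, ← hr', ← hr]
      exact φ.toAdd.apply_symm_apply g
    obtain ⟨ε, k, rfl⟩ := MonoidAlgebra.exists_eq_of_mul_eq_one hrr
    refine ⟨(ε, k), Multiplicative.toAdd.injective (AddEquiv.ext fun g => ?_)⟩
    rw [plusMinusAct_apply, ← smul_assoc]
    exact (hr g).symm

end GroupRing

theorem proposition3 (H : Subgroup {q : ℚ // 0 < q}) :
    ∃ (G : Type) (_ : AddCommGroup G) (_ : Module (MonoidAlgebra ℤ H) G)
      (F : ℕ → Finset H) (s t k l : ℕ → ℕ)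
      (Gn : ℕ → Submodule (MonoidAlgebra ℤ H) G)
      (seq : (n : ℕ) → (Fin n → Bool) → G) (c : ℕ → ℕ → G),
      IsReducedAddGroup G ∧
      (∀ n, 0 < s n ∧ 0 < t n ∧ 0 < k n ∧ 0 < l n) ∧
      AutEqPlusMinus H G ∧
      (Monotone Gn ∧ (⋃ n, (Gn n : Set G)) = Set.univ) ∧
      (∀ n, ∃ b : Module.Basis ((Fin n → Bool) ⊕ Set.Icc 1 n) (MonoidAlgebra ℤ H) (Gn n),
        (∀ y, (b (Sum.inl y) : G) = seq n y) ∧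
        (∀ i, (b (Sum.inr i) : G) = c n i)) ∧
      (∀ (n : ℕ) (y : Fin n → Bool),
        seq n y = seq (n + 1) (Fin.snoc y false) + (s n ^ 2) • seq (n + 1) (Fin.snoc y true)) ∧
      (∀ (n i : ℕ), 1 ≤ i → i ≤ n →
        ∃ N : H → (Fin n → Bool) → ℤ,
          (∀ h y, 0 ≤ N h y ∧ N h y < (s n : ℤ) * (t n : ℤ)) ∧
          c n i - (s n * t n) • c (n + 1) i =
            ∑ h ∈ F i, ∑ y : Fin n → Bool,
              N h y • (MonoidAlgebra.of ℤ H h • seq (n + 1) (Fin.snoc y false))) ∧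
      (k 0 = 1 ∧ (∀ n, k (n + 1) = s n * k n) ∧ l 0 = 1 ∧ (∀ n, l (n + 1) = t n * l n)) ∧
      (∀ m : ℕ, 0 < m → ∀ᶠ n in Filter.atTop, m ∣ k n ∧ m ∣ l n) ∧
      (∀ n, (k n : ℚ) * ((s n : ℚ) ^ 2 - 1) ≥
        (l n : ℚ) * (s n : ℚ) * (t n : ℚ) *
          ∑ i ∈ Finset.Icc 1 n, ∑ h ∈ F i, ((h : {q : ℚ // 0 < q}) : ℚ)) := by
  classical
  obtain ⟨inst, D, hu, ht, hs⟩ := exists_cornerData H (fun h => ((h : {q : ℚ // 0 < q}) : ℚ))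
  have hl : ∀ n, ∏ m ∈ Finset.range n, D.t m = n.factorial := fun n => by
    rw [← Finset.prod_range_add_one_eq_factorial]
    exact Finset.prod_congr rfl fun m _ => ht m
  have hk : ∀ n, 0 < ∏ m ∈ Finset.range n, D.s m := fun n => Finset.prod_pos fun m _ => D.s_pos m
  refine ⟨D.Carrier, inferInstance, inferInstance, D.F, D.s, D.t,
    fun n => ∏ m ∈ Finset.range n, D.s m, fun n => ∏ m ∈ Finset.range n, D.t m, D.chain,
    fun n y => D.elt _ (D.seq_mem n y),
    fun n i => if h : 1 ≤ i ∧ i ≤ n then D.elt _ (D.c_mem h.1 h.2) else 0,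
    D.isReducedAddGroup, fun n => ⟨D.s_pos n, D.t_pos n, hk n, ?_⟩, D.autEqPlusMinus,
    ⟨D.chain_mono, D.iUnion_chain⟩, fun n => ?_, fun n y => ?_, fun n i hi hin => ?_,
    ⟨Finset.prod_range_zero _, fun n => ?_, Finset.prod_range_zero _, fun n => ?_⟩,
    fun m hm => ?_, fun n => ?_⟩
  · exact Finset.prod_pos fun m _ => D.t_pos m
  · refine ⟨D.chainBasis n, fun y => D.coe_chainBasis n _, fun i => ?_⟩
    dsimp only
    rw [dif_pos ⟨i.2.1, i.2.2⟩]
    exact D.coe_chainBasis n _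
  · apply D.incl_injective
    rw [map_add, map_nsmul]
    exact D.seq_eq y
  · obtain ⟨N, hN, h⟩ := D.c_sub_smul_c_succ hin
    refine ⟨N, hN, D.incl_injective ?_⟩
    dsimp only
    rw [dif_pos ⟨hi, hin⟩, dif_pos ⟨hi, hin.trans n.le_succ⟩]
    simp only [map_sub, map_nsmul, map_sum, map_zsmul, map_smul, CornerData.incl_elt]
    rw [h, hu]
  · dsimp only
    rw [Finset.prod_range_succ, mul_comm]
  · dsimp only
    rw [Finset.prod_range_succ, mul_comm]
  · filter_upwards [Filter.eventually_ge_atTop m] with n hn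
    have h1 : m ∣ ∏ m ∈ Finset.range n, D.t m := by
      rw [hl]
      exact Nat.dvd_factorial hm hn
    exact ⟨h1.trans (Finset.prod_dvd_prod_of_dvd _ _ fun m _ => D.t_dvd m), h1⟩
  · have hs' := hs n
    have hk' : (1 : ℚ) ≤ (∏ m ∈ Finset.range n, D.s m : ℕ) := by exact_mod_cast hk n
    have h1 : (1 : ℚ) ≤ D.s n := by exact_mod_cast D.s_pos n
    dsimp only
    rw [hl, ht]
    set w := ∑ i ∈ Finset.Icc 1 n, ∑ h ∈ D.F i, ((h : {q : ℚ // 0 < q}) : ℚ)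
    push_cast
    push_cast at hk'
    calc (n.factorial : ℚ) * D.s n * (n + 1) * w = D.s n * (n.factorial * (n + 1) * w) := by ring
      _ ≤ D.s n * (D.s n - 1) := by gcongr; linarith
      _ ≤ 1 * ((D.s n : ℚ) ^ 2 - 1) := by nlinarith
      _ ≤ _ := mul_le_mul_of_nonneg_right hk' (by nlinarith)
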